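/- For $\tau$ in the upper half-plane put $q=e^{2\pi i\tau}$ and let a prime denote $q\frac{d}{dq}=\frac1{2\pi i}\frac{d}{d\tau}$. Define $$\mathcal P=1-8\sum_{n\ge1}\frac{(-1)^n n q^n}{1-q^n},\quad \tilde{\mathcal P}=1+24\sum_{n\ge1}\frac{nq^n}{1+q^n},\quad \mathcal Q=1+16\sum_{n\ge1}\frac{(-1)^n n^3q^n}{1-q^n},\quad \mathcal D=\tfrac1{64}(\tilde{\mathcal P}^2-\mathcal Q),\quad \tilde{\mathcal D}=\mathcal D\mathcal Q .$$ For a holomorphic function $f$ and a weight $k$ put $$B_k=kff''-(k+1)f'^2,\qquad A_k=k^2f^2f'''-3k(k+2)ff'f''+2(k+1)(k+2)f'^3,$$ $$C_k=k(k+1)ff''''-4(k+1)(k+3)f'f'''+3(k+2)(k+3)f''^2,$$ $$I_k=\frac{B_k}{f^{2+4/k}},\qquad J_k=\frac{A_k}{f^{3+6/k}},\qquad P_k=\frac{A_k^2}{B_k^3},\qquad Q_k=\frac{f^2C_k}{B_k^2},$$ where the powers of $f$ are formed with one and the same (arbitrary) value of $\log f$. Then the following hold. (0) $\mathcal P$ is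 holomorphic on the upper half-plane, and $$\mathcal P'=\tfrac14(\mathcal P^2-\mathcal Q),\qquad \tilde{\mathcal P}'=\tfrac12(\mathcal P\tilde{\mathcal P}-\mathcal Q),\qquad \mathcal Q'=(\mathcal P-\tilde{\mathcal P})\mathcal Q .$$ Moreover $\tilde{\mathcal P}$, $\mathcal Q$, $\mathcal D$ are modular forms on $\Gamma_0(2)$ of weights $2,4,4$, and $\tilde{\mathcal D}$ is a cusp form of weight $8$ on $\Gamma_0(2)$. (1) $f=\tilde{\mathcal P}$ satisfies $$3f^2f'''^2-36(ff'f''-f'^3)f'''+32ff''^3-3(12f'^2+f^4)f''^2+9f^3f'^2f''-\tfrac{27}4f^2f'^4=0,$$ and, wherever $f\ne0$, $\;3J_2^2+64I_2^3-12I_2^2=0$. (2) $f=\mathcal Q$ satisfies $$4f^4f'''^2-6f^2f'(6ff''-5f'^2)f'''+16f^3f''^3+f^2(21f'^2-4f^3)f''^2-10ff'^2(6f'^2-f^3)f''+25f'^6-\tfrac{25}4f^3f'^4=0,$$ and, wherever $f\ne0$, $\;J_4^2+16I_4^3-16I_4^2=0$. (3) $f=\mathcal D$ satisfies $$4f^4f'''^2-6f^2f'(6ff''-5f'^2)f'''+16f^3f''^3-f^2(256f^3-21f'^2)f''^2+20ff'^2(32f^3-3f'^2)f''+25f'^6-400f^3f'^4=0,$$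 and, wherever $f\ne0$, $\;J_4^2+16I_4^3-1024I_4^2=0$. (4) $f=\tilde{\mathcal D}$ satisfies $$16f^4f'''^2-30f^2f'(4ff''-3f'^2)f'''+32f^3f''^3+117f^2f'^2f''^2-8f(16f^5+27f'^4)f''+81f'^6+144f^5f'^2=0,$$ and, wherever $f\ne0$, $\;J_8^2+16I_8^3-4096I_8=0$. (5) The following fourth-order equations hold wherever $B_k\neq0$ and, after multiplication by $B_k^3$, on the whole upper half-plane: $128Q_8-9P_8-912=0$ for $\tilde{\mathcal D}$; $4Q_2-3P_2-64=0$ for $\tilde{\mathcal P}$; and $16Q_4-5P_4-176=0$ for both $\mathcal Q$ and $\mathcal D$. -/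

import Mathlib

open scoped UpperHalfPlane MatrixGroups Manifold

noncomputable section

namespace GammaZeroTwo

/-- The nome `q = exp (2 π i τ)`. -/
def nome (τ : ℍ) : ℂ := Complex.exp (2 * Real.pi * Complex.I * (τ : ℂ))

/-- The derivation `q d/dq = (2 π i)⁻¹ d/dτ` on functions on the upper half-plane
(denoted by a prime in the comments below). -/
abbrev dq (f : ℍ → ℂ) : ℍ → ℂ := Derivative.normalizedDerivOfComplex f

/-- `P = 1 - 8 ∑_{n ≥ 1} (-1)^n n q^n / (1 - q^n)`. -/
def P (τ : ℍ) : ℂ :=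
  1 - 8 * ∑' n : ℕ+, (-1 : ℂ) ^ (n : ℕ) * (n : ℂ) * nome τ ^ (n : ℕ) / (1 - nome τ ^ (n : ℕ))

/-- `P̃ = 1 + 24 ∑_{n ≥ 1} n q^n / (1 + q^n)`. -/
def Pt (τ : ℍ) : ℂ :=
  1 + 24 * ∑' n : ℕ+, (n : ℂ) * nome τ ^ (n : ℕ) / (1 + nome τ ^ (n : ℕ))

/-- `Q = 1 + 16 ∑_{n ≥ 1} (-1)^n n^3 q^n / (1 - q^n)`. -/
def Q (τ : ℍ) : ℂ :=
  1 + 16 * ∑' n : ℕ+,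
    (-1 : ℂ) ^ (n : ℕ) * (n : ℂ) ^ 3 * nome τ ^ (n : ℕ) / (1 - nome τ ^ (n : ℕ))

/-- `D = (P̃² - Q) / 64`. -/
def D (τ : ℍ) : ℂ := (Pt τ ^ 2 - Q τ) / 64

/-- `D̃ = D Q`. -/
def Dt (τ : ℍ) : ℂ := D τ * Q τ

/-- `k f f'' - (k+1) f'²`. -/
def covB (k : ℂ) (f : ℍ → ℂ) (τ : ℍ) : ℂ :=
  k * f τ * dq (dq f) τ - (k + 1) * dq f τ ^ 2

/-- `k² f² f''' - 3 k (k+2) f f' f'' + 2 (k+1) (k+2) f'³`. -/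
def covA (k : ℂ) (f : ℍ → ℂ) (τ : ℍ) : ℂ :=
  k ^ 2 * f τ ^ 2 * dq (dq (dq f)) τ - 3 * k * (k + 2) * f τ * dq f τ * dq (dq f) τ
    + 2 * (k + 1) * (k + 2) * dq f τ ^ 3

/-- `k (k+1) f f'''' - 4 (k+1) (k+3) f' f''' + 3 (k+2) (k+3) f''²`. -/
def covC (k : ℂ) (f : ℍ → ℂ) (τ : ℍ) : ℂ :=
  k * (k + 1) * f τ * dq (dq (dq (dq f))) τ - 4 * (k + 1) * (k + 3) * dq f τ * dq (dq (dq f)) τ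
    + 3 * (k + 2) * (k + 3) * dq (dq f) τ ^ 2

/-- The differential invariant `I_k = (k f f'' - (k+1) f'²) / f^(2+4/k)` at `τ`. The argument `l`
is a value of `log (f τ)`, fixing the branch of the power: `f^s = exp (s l)`. -/
def invI (k : ℂ) (f : ℍ → ℂ) (l : ℂ) (τ : ℍ) : ℂ :=
  covB k f τ / Complex.exp ((2 + 4 / k) * l)

/-- The differential invariant
`J_k = (k² f² f''' - 3 k (k+2) f f' f'' + 2 (k+1) (k+2) f'³) / f^(3+6/k)` at `τ`, with the same
convention on the power: `l` is a value of `log (f τ)`. -/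
def invJ (k : ℂ) (f : ℍ → ℂ) (l : ℂ) (τ : ℍ) : ℂ :=
  covA k f τ / Complex.exp ((3 + 6 / k) * l)

/-- The differential invariant `P_k`, meaningful where `k f f'' - (k+1) f'² ≠ 0`. -/
def invP (k : ℂ) (f : ℍ → ℂ) (τ : ℍ) : ℂ := covA k f τ ^ 2 / covB k f τ ^ 3

/-- The differential invariant `Q_k`, meaningful where `k f f'' - (k+1) f'² ≠ 0`. -/
def invQ (k : ℂ) (f : ℍ → ℂ) (τ : ℍ) : ℂ := f τ ^ 2 * covC k f τ / covB k f τ ^ 2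

/-- `f` satisfies the fourth-order equation `a Q_k + b P_k + c = 0`: in invariant form wherever
`P_k` and `Q_k` are defined, and, with denominators cleared, on the whole upper half-plane. -/
def SatisfiesLinearPQ (k a b c : ℂ) (f : ℍ → ℂ) : Prop :=
  (∀ τ : ℍ, covB k f τ ≠ 0 → a * invQ k f τ + b * invP k f τ + c = 0) ∧
  (∀ τ : ℍ, a * (f τ ^ 2 * covC k f τ * covB k f τ) + b * covA k f τ ^ 2
    + c * covB k f τ ^ 3 = 0)

end GammaZeroTwo

end

/-!
A form on `Γ₀(2)` of weight less than `8` that vanishes at both cusps is zero, as its cube divided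
by `Δ(τ) Δ(2τ)` is a modular form of negative weight. Comparing values at the cusps therefore proves
Ramanujan's system for `P`, `P̃`, `Q`, which are combinations of `E₂`, `E₄` at `τ` and `2τ`. In
terms of the derivation `∂ₖ f = f' - (k/4) P f` the system reads `∂P̃ = -Q/2`, `∂Q = -P̃ Q`,
`∂D = 0`, `∂D̃ = -P̃ D̃`. The expressions `A_k`, `B_k`, `C_k` are covariants: when the derivatives
of `f` are rewritten through `∂`, all terms containing `P` cancel. Hence every differential equation
becomes a polynomial identity in `P̃` and `Q`.
-/

noncomputable section

namespace GammaZeroTwo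

open UpperHalfPlane Filter Topology
open scoped ModularForm

/-- The Lambert series `∑ n ^ k r ^ n / (1 - r ^ n)`, through which all the Eisenstein series are
expressed. -/
def lambert (k : ℕ) (r : ℂ) : ℂ :=
  ∑' n : ℕ+, (n : ℂ) ^ k * r ^ (n : ℕ) / (1 - r ^ (n : ℕ))

section Lambert

variable (k : ℕ) {r : ℂ}

lemma norm_pow_lt_one {n : ℕ} (hr : ‖r‖ < 1) (hn : n ≠ 0) : ‖r ^ n‖ < 1 := by
  rw [norm_pow]
  exact pow_lt_one₀ (norm_nonneg r) hr hn

lemma one_sub_pow_ne_zero {n : ℕ} (hr : ‖r‖ < 1) (hn : n ≠ 0) : 1 - r ^ n ≠ 0 := by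
  intro h
  simpa [← sub_eq_zero.mp h] using norm_pow_lt_one hr hn

lemma summable_lambert (hr : ‖r‖ < 1) :
    Summable fun n : ℕ+ ↦ (n : ℂ) ^ k * r ^ (n : ℕ) / (1 - r ^ (n : ℕ)) :=
  (summable_norm_pow_mul_geometric_div_one_sub k hr).comp_injective PNat.coe_injective

lemma tendsto_lambert_zero : Tendsto (lambert k) (𝓝 0) (𝓝 0) := by
  have hbound : Summable fun n : ℕ+ ↦ 2 * ((n : ℝ) ^ k * (1 / 2) ^ (n : ℕ)) :=
    ((summable_pow_mul_geometric_of_norm_lt_one k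
      (by norm_num : ‖(1 / 2 : ℝ)‖ < 1)).comp_injective PNat.coe_injective).mul_left 2
  have hterm (n : ℕ+) : Tendsto (fun r : ℂ ↦ (n : ℂ) ^ k * r ^ (n : ℕ) / (1 - r ^ (n : ℕ)))
      (𝓝 0) (𝓝 0) := by
    have : ContinuousAt (fun r : ℂ ↦ (n : ℂ) ^ k * r ^ (n : ℕ) / (1 - r ^ (n : ℕ))) 0 :=
      ContinuousAt.div (by fun_prop) (by fun_prop) (by simp)
    simpa [ContinuousAt] using this
  have hle : ∀ᶠ r : ℂ in 𝓝 0, ∀ n : ℕ+, ‖(n : ℂ) ^ k * r ^ (n : ℕ) / (1 - r ^ (n : ℕ))‖ ≤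
      2 * ((n : ℝ) ^ k * (1 / 2) ^ (n : ℕ)) := by
    filter_upwards [Metric.closedBall_mem_nhds (0 : ℂ) one_half_pos] with r hr n
    rw [mem_closedBall_zero_iff] at hr
    have hpow : ‖r‖ ^ (n : ℕ) ≤ (1 / 2) ^ (n : ℕ) := by gcongr
    have hhalf : (1 / 2 : ℝ) ^ (n : ℕ) ≤ 1 / 2 :=
      pow_le_of_le_one (by norm_num) (by norm_num) n.ne_zero
    have hden : 1 / 2 ≤ ‖1 - r ^ (n : ℕ)‖ := by
      have := norm_sub_norm_le 1 (r ^ (n : ℕ))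
      rw [norm_one, norm_pow] at this
      linarith
    rw [norm_div, norm_mul, norm_pow, norm_pow, Complex.norm_natCast, div_le_iff₀ (by linarith)]
    calc (n : ℝ) ^ k * ‖r‖ ^ (n : ℕ) ≤ 2 * ((n : ℝ) ^ k * (1 / 2) ^ (n : ℕ)) * (1 / 2) := by
          rw [mul_comm 2, mul_assoc _ 2, mul_one_div_cancel two_ne_zero, mul_one]
          gcongr
      _ ≤ _ := by gcongr
  have := tendsto_tsum_of_dominated_convergence hbound hterm hle
  rwa [tsum_zero] at this

lemma hasSum_indicator_even_lambert (hr : ‖r‖ < 1) :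
    HasSum ({n : ℕ+ | Even (n : ℕ)}.indicator
      fun n : ℕ+ ↦ (n : ℂ) ^ k * r ^ (n : ℕ) / (1 - r ^ (n : ℕ))) (2 ^ k * lambert k (r ^ 2)) := by
  have hrange : {n : ℕ+ | Even (n : ℕ)} ⊆ Set.range fun m : ℕ+ ↦ 2 * m := by
    rintro n ⟨m, hm⟩
    exact ⟨⟨m, by have := n.pos; omega⟩, PNat.eq ((two_mul m).trans hm.symm)⟩
  refine ((mul_right_injective (2 : ℕ+)).hasSum_iff ?_).mp ?_
  · exact fun n hn ↦ Set.indicator_of_notMem (mt (hrange ·) hn) _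
  · refine HasSum.congr_fun ((summable_lambert k
      (norm_pow_lt_one hr two_ne_zero)).hasSum.mul_left (2 ^ k)) fun n ↦ ?_
    rw [Function.comp_apply, Set.indicator_of_mem (by simp)]
    simp only [PNat.mul_coe, PNat.val_ofNat, Nat.cast_mul, Nat.cast_ofNat, pow_mul, mul_pow]
    ring

lemma tsum_neg_one_pow_mul_lambert (hr : ‖r‖ < 1) :
    ∑' n : ℕ+, (-1 : ℂ) ^ (n : ℕ) * (n : ℂ) ^ k * r ^ (n : ℕ) / (1 - r ^ (n : ℕ))
      = 2 ^ (k + 1) * lambert k (r ^ 2) - lambert k r := by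
  have h := (((hasSum_indicator_even_lambert k hr).mul_left 2).sub
    (summable_lambert k hr).hasSum).tsum_eq
  rw [pow_succ, mul_comm (2 ^ k) 2, mul_assoc]
  refine Eq.trans (tsum_congr fun n ↦ ?_) h
  by_cases hn : Even (n : ℕ)
  · rw [Set.indicator_of_mem (show n ∈ {n : ℕ+ | Even (n : ℕ)} from hn), hn.neg_one_pow]
    ring
  · rw [Set.indicator_of_notMem (show n ∉ {n : ℕ+ | Even (n : ℕ)} from hn),
      (Nat.not_even_iff_odd.mp hn).neg_one_pow]
    ring

lemma tsum_div_one_add_eq_lambert (hr : ‖r‖ < 1) :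
    ∑' n : ℕ+, (n : ℂ) ^ k * r ^ (n : ℕ) / (1 + r ^ (n : ℕ))
      = lambert k r - 2 * lambert k (r ^ 2) := by
  have h := ((summable_lambert k hr).hasSum.sub
    ((summable_lambert k (norm_pow_lt_one hr two_ne_zero)).hasSum.mul_left 2)).tsum_eq
  refine Eq.trans (tsum_congr fun n ↦ ?_) h
  have hsub := one_sub_pow_ne_zero hr n.ne_zero
  have hsub_sq := one_sub_pow_ne_zero hr (mul_ne_zero n.ne_zero two_ne_zero)
  have hfactor : 1 - (r ^ (n : ℕ)) ^ 2 = (1 - r ^ (n : ℕ)) * (1 + r ^ (n : ℕ)) := by ring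
  rw [pow_mul, hfactor] at hsub_sq
  have hadd := right_ne_zero_of_mul hsub_sq
  rw [pow_right_comm, hfactor]
  field_simp
  ring

end Lambert

lemma norm_nome_lt_one (τ : ℍ) : ‖nome τ‖ < 1 := norm_exp_two_pi_I_lt_one τ

lemma tendsto_nome : Tendsto nome atImInfty (𝓝 0) := by
  refine (qParam_tendsto_atImInfty one_pos).congr fun τ ↦ ?_
  simp [nome, Function.Periodic.qParam]

lemma E2_eq_lambert (τ : ℍ) : EisensteinSeries.E2 τ = 1 - 24 * lambert 1 (nome τ) := by
  rw [EisensteinSeries.E2_eq_tsum_cexp, lambert,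
    tsum_pow_div_one_sub_eq_tsum_sigma (norm_nome_lt_one τ) 1]
  rfl

lemma E₄_eq_lambert (τ : ℍ) : ModularForm.E₄ τ = 1 + 240 * lambert 3 (nome τ) := by
  rw [lambert, tsum_pow_div_one_sub_eq_tsum_sigma (norm_nome_lt_one τ) 3, ModularForm.E₄,
    EisensteinSeries.q_expansion_bernoulli (k := 4) (by norm_num) ⟨2, rfl⟩ τ,
    show bernoulli 4 = -1 / 30 by decide +kernel]
  simp only [zpow_natCast, nome]
  norm_num

lemma tendsto_E2 : Tendsto EisensteinSeries.E2 atImInfty (𝓝 1) := by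
  rw [funext E2_eq_lambert]
  simpa using (((tendsto_lambert_zero 1).comp tendsto_nome).const_mul 24).const_sub 1

lemma tendsto_E₄ : Tendsto ModularForm.E₄ atImInfty (𝓝 1) := by
  rw [funext E₄_eq_lambert]
  simpa using (((tendsto_lambert_zero 3).comp tendsto_nome).const_mul 240).const_add 1

section Dilation

variable {f : ℍ → ℂ} (c : {x : ℝ // 0 < x})

lemma tendsto_pos_real_smul : Tendsto (fun τ : ℍ ↦ c • τ) atImInfty atImInfty := by
  refine tendsto_comap_iff.mpr ?_
  rw [show im ∘ (fun τ : ℍ ↦ c • τ) = fun τ ↦ (c : ℝ) * τ.im from funext (pos_real_im c)]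
  exact tendsto_comap.const_mul_atTop c.2

lemma mdifferentiable_comp_pos_real_smul (hf : MDiff f) : MDiff fun τ : ℍ ↦ f (c • τ) := by
  rw [UpperHalfPlane.mdifferentiable_iff] at hf ⊢
  have hmaps : Set.MapsTo (fun z : ℂ ↦ ((c : ℝ) : ℂ) * z) upperHalfPlaneSet upperHalfPlaneSet :=
    fun z hz ↦ by simpa using mul_pos c.2 hz
  refine (hf.comp (by fun_prop) hmaps).congr fun z hz ↦ ?_
  simp only [Function.comp_apply]
  congr 1
  ext
  rw [ofComplex_apply_of_im_pos (hmaps hz), coe_pos_real_smul, ofComplex_apply_of_im_pos hz,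
    Complex.real_smul]

lemma pos_real_smul_S_smul (τ : ℍ) : c • ModularGroup.S • τ = ModularGroup.S • (c⁻¹ • τ : ℍ) := by
  ext
  simp only [coe_pos_real_smul, modular_S_smul, Complex.real_smul, Positive.coe_inv,
    Complex.ofReal_inv]
  rw [inv_neg, inv_neg, mul_inv, inv_inv, mul_neg]

lemma slash_S_apply (k : ℤ) (f : ℍ → ℂ) (τ : ℍ) :
    (f ∣[k] ModularGroup.S) τ = f (ModularGroup.S • τ) * (τ : ℂ) ^ (-k) := by
  rw [ModularForm.SL_slash_apply, ModularGroup.denom_S]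

lemma slash_S_comp_pos_real_smul (k : ℤ) (f : ℍ → ℂ) :
    (fun τ : ℍ ↦ f (c • τ)) ∣[k] ModularGroup.S =
      fun τ : ℍ ↦ ((c : ℝ) : ℂ) ^ (-k) * (f ∣[k] ModularGroup.S) (c⁻¹ • τ : ℍ) := by
  ext τ
  rw [slash_S_apply, slash_S_apply, pos_real_smul_S_smul, coe_pos_real_smul, Complex.real_smul,
    Positive.coe_inv, Complex.ofReal_inv, mul_zpow, inv_zpow', neg_neg, mul_left_comm,
    ← mul_assoc (_ ^ (-k)), zpow_neg_mul_zpow_self k (mod_cast c.2.ne'), one_mul]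

variable {c}

/-- Conjugation by `diag(N, 1)` maps `Γ₀(N)` into `SL(2, ℤ)`. -/
lemma exists_pos_real_smul_smul_eq {N : ℕ} (hc : (c : ℝ) = N) {γ : SL(2, ℤ)}
    (hγ : γ ∈ CongruenceSubgroup.Gamma0 N) :
    ∃ γ' : SL(2, ℤ), N * γ' 1 0 = γ 1 0 ∧
      ∀ τ : ℍ, c • γ • τ = γ' • c • τ ∧ denom γ' (c • τ : ℍ) = denom γ τ := by
  obtain ⟨m, hm⟩ := (ZMod.intCast_zmod_eq_zero_iff_dvd _ N).mp
    (CongruenceSubgroup.Gamma0_mem.mp hγ)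
  have hdet := Matrix.SpecialLinearGroup.det_coe γ
  rw [Matrix.det_fin_two, hm] at hdet
  obtain ⟨γ', h00, h01, h10, h11⟩ : ∃ γ' : SL(2, ℤ), γ' 0 0 = γ 0 0 ∧ γ' 0 1 = N * γ 0 1 ∧
      γ' 1 0 = m ∧ γ' 1 1 = γ 1 1 :=
    ⟨⟨!![γ 0 0, N * γ 0 1; m, γ 1 1], by rw [Matrix.det_fin_two_of]; linarith⟩, by simp⟩
  have hdenom (τ : ℍ) : denom γ' (c • τ : ℍ) = denom γ τ := by
    rw [ModularGroup.denom_apply, ModularGroup.denom_apply, coe_pos_real_smul, hc, hm, h10, h11]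
    push_cast
    rw [Complex.real_smul]
    push_cast
    ring
  refine ⟨γ', by rw [h10, hm], fun τ ↦ ⟨?_, hdenom τ⟩⟩
  ext
  simp only [coe_pos_real_smul, coe_specialLinearGroup_apply, hm, h00, h01, h10, h11, hc,
    Complex.real_smul, algebraMap_int_eq, eq_intCast]
  push_cast
  rw [← mul_div_assoc]
  congr 1 <;> ring

end Dilation

section Derivative

variable {f : ℍ → ℂ} {a : ℂ}

lemma norm_deriv_comp_ofComplex_le (hf : MDiff f) {C : ℝ} {τ : ℍ} (hτ : 1 < τ.im)
    (hC : ∀ w : ℍ, τ.im - 1 ≤ w.im → ‖f w - a‖ ≤ C) : ‖deriv (f ∘ ofComplex) τ‖ ≤ C := by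
  rw [UpperHalfPlane.mdifferentiable_iff] at hf
  have him : ∀ z ∈ Metric.closedBall (τ : ℂ) 1, τ.im - 1 ≤ z.im := fun z hz ↦ by
    have h := (abs_le.mp ((Complex.abs_im_le_norm (z - τ)).trans
      (by simpa [dist_eq_norm] using hz))).1
    rw [Complex.sub_im, coe_im] at h
    linarith
  have hpos : ∀ z ∈ Metric.closedBall (τ : ℂ) 1, 0 < z.im := fun z hz ↦
    (sub_pos.mpr hτ).trans_le (him z hz)
  have hdiff : DifferentiableOn ℂ (fun z ↦ (f ∘ ofComplex) z - a) (Metric.closedBall (τ : ℂ) 1) :=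
    (hf.mono hpos).sub_const a
  have hcauchy := Complex.norm_deriv_le_of_forall_mem_sphere_norm_le one_pos
    (hdiff.diffContOnCl_ball subset_rfl) fun z hz ↦ by
      have hz := Metric.sphere_subset_closedBall hz
      rw [Function.comp_apply, ofComplex_apply_of_im_pos (hpos z hz)]
      exact hC _ (him z hz)
  rwa [deriv_sub_const, div_one] at hcauchy

lemma tendsto_dq_zero (hf : MDiff f) (ha : Tendsto f atImInfty (𝓝 a)) :
    Tendsto (dq f) atImInfty (𝓝 0) := by
  have hderiv : Tendsto (fun τ : ℍ ↦ deriv (f ∘ ofComplex) τ) atImInfty (𝓝 0) := by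
    rw [Metric.tendsto_nhds]
    intro ε hε
    obtain ⟨A, hA⟩ := (atImInfty_mem _).mp (Metric.tendsto_nhds.mp ha (ε / 2) (half_pos hε))
    refine (atImInfty_mem _).mpr ⟨max A 0 + 2, fun τ hτ ↦ ?_⟩
    have hA' := le_max_left A 0
    have h0 := le_max_right A 0
    have hle := norm_deriv_comp_ofComplex_le hf (a := a) (C := ε / 2) (τ := τ) (by linarith)
      fun w hw ↦ (dist_eq_norm (f w) a).symm.trans_le (hA w (by linarith)).le
    simpa using hle.trans_lt (half_lt_self hε)
  have h := hderiv.const_mul (2 * Real.pi * Complex.I)⁻¹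
  rwa [mul_zero] at h

lemma tendsto_serreDerivative (k : ℂ) (hf : MDiff f) (ha : Tendsto f atImInfty (𝓝 a)) :
    Tendsto (Derivative.serreDerivative k f) atImInfty (𝓝 (-(k / 12) * a)) := by
  have h := (tendsto_dq_zero hf ha).sub ((tendsto_E2.const_mul (k * 12⁻¹)).mul ha)
  rwa [show 0 - k * 12⁻¹ * 1 * a = -(k / 12) * a by ring] at h

/-- The logarithmic derivative `j'/j` of `j(τ) = denom γ τ`, where `' = q d/dq`: the cocycle by
which `E₂ / 12` fails to be modular. -/
def logDerivDenom (γ : SL(2, ℤ)) (τ : ℍ) : ℂ := (2 * Real.pi * Complex.I)⁻¹ * (γ 1 0 / denom γ τ)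

lemma mdifferentiable_logDerivDenom (γ : SL(2, ℤ)) : MDiff (logDerivDenom γ) :=
  ((mdifferentiable_inv_denom (γ : GL (Fin 2) ℝ)).const_smul (γ 1 0 : ℂ)).const_smul
    (2 * Real.pi * Complex.I : ℂ)⁻¹

lemma dq_logDerivDenom (γ : SL(2, ℤ)) : dq (logDerivDenom γ) = -logDerivDenom γ ^ 2 := by
  have hinv := mdifferentiable_inv_denom (γ : GL (Fin 2) ℝ)
  have hsmul : logDerivDenom γ = ((2 * Real.pi * Complex.I)⁻¹ * γ 1 0 : ℂ) •
      fun τ : ℍ ↦ (denom γ τ)⁻¹ := by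
    ext τ
    simp only [logDerivDenom, Pi.smul_apply, smul_eq_mul, div_eq_mul_inv, mul_assoc]
  ext τ
  have hderiv : deriv ((fun τ : ℍ ↦ (denom γ τ)⁻¹) ∘ ofComplex) τ = -γ 1 0 / denom γ τ ^ 2 := by
    have hev : (fun τ : ℍ ↦ (denom γ τ)⁻¹) ∘ ofComplex =ᶠ[𝓝 (τ : ℂ)]
        fun z ↦ denom γ z ^ (-1 : ℤ) := by
      filter_upwards [isOpen_upperHalfPlaneSet.mem_nhds τ.im_pos] with z hz
      rw [Function.comp_apply, ofComplex_apply_of_im_pos hz, zpow_neg_one, coe_mk]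
    rw [hev.deriv_eq, deriv_denom_zpow, Int.cast_neg, Int.cast_one, neg_one_mul, div_eq_mul_inv,
      ← zpow_natCast, ← zpow_neg]
    rfl
  rw [hsmul, dq, Derivative.normalizedDerivOfComplex_smul _ _ hinv]
  simp only [Pi.smul_apply, Pi.neg_apply, Pi.pow_apply, smul_eq_mul,
    Derivative.normalizedDerivOfComplex, hderiv]
  ring

lemma dq_slash (k : ℤ) (hf : MDiff f) (γ : SL(2, ℤ)) :
    dq f ∣[k + 2] γ = dq (f ∣[k] γ) + (k : ℂ) • (logDerivDenom γ * (f ∣[k] γ)) := by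
  rw [dq, dq, Derivative.normalizedDerivOfComplex_SL_slash hf]
  ext τ
  simp only [Pi.add_apply, Pi.sub_apply, Pi.smul_apply, Pi.mul_apply, smul_eq_mul, logDerivDenom]
  ring

lemma E2_slash (γ : SL(2, ℤ)) :
    EisensteinSeries.E2 ∣[(2 : ℤ)] γ = EisensteinSeries.E2 + (12 : ℂ) • logDerivDenom γ := by
  ext τ
  have hpi : (Real.pi : ℂ) ≠ 0 := mod_cast Real.pi_ne_zero
  rw [EisensteinSeries.E2_slash_action]
  simp only [Pi.sub_apply, Pi.add_apply, Pi.smul_apply, smul_eq_mul, EisensteinSeries.D2,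
    riemannZeta_two, logDerivDenom, mul_inv, Complex.inv_I]
  field_simp
  ring

end Derivative

/-- The number `2` as a positive real, so that `posTwo • τ` is the point `2 τ` of the upper
half-plane. -/
def posTwo : {x : ℝ // 0 < x} := ⟨2, two_pos⟩

lemma nome_posTwo_smul (τ : ℍ) : nome (posTwo • τ) = nome τ ^ 2 := by
  rw [nome, nome, ← Complex.exp_nat_mul, coe_pos_real_smul, Complex.real_smul]
  congr 1
  simp only [posTwo, Complex.ofReal_ofNat, Nat.cast_ofNat]
  ring

lemma Pt_eq_E2 : Pt = fun τ ↦ 2 * EisensteinSeries.E2 (posTwo • τ) - EisensteinSeries.E2 τ := by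
  ext τ
  have h := tsum_div_one_add_eq_lambert 1 (norm_nome_lt_one τ)
  simp only [pow_one] at h
  rw [Pt, h, E2_eq_lambert, E2_eq_lambert, nome_posTwo_smul]
  ring

lemma P_eq_E2 (τ : ℍ) : P τ = (EisensteinSeries.E2 τ + 2 * Pt τ) / 3 := by
  have h := tsum_neg_one_pow_mul_lambert 1 (norm_nome_lt_one τ)
  simp only [pow_one] at h
  simp only [P, h, Pt_eq_E2, E2_eq_lambert, nome_posTwo_smul]
  ring

lemma Q_eq_E₄ :
    Q = fun τ ↦ (16 * ModularForm.E₄ (posTwo • τ) - ModularForm.E₄ τ) / 15 := by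
  ext τ
  rw [Q, tsum_neg_one_pow_mul_lambert 3 (norm_nome_lt_one τ), E₄_eq_lambert, E₄_eq_lambert,
    nome_posTwo_smul]
  ring

lemma mem_Gamma0_two_iff {γ : SL(2, ℤ)} : γ ∈ CongruenceSubgroup.Gamma0 2 ↔ Even (γ 1 0) := by
  rw [CongruenceSubgroup.Gamma0_mem, ZMod.intCast_zmod_eq_zero_iff_dvd, even_iff_two_dvd]
  rfl

lemma coe_S_inv : ((ModularGroup.S⁻¹ : SL(2, ℤ)) : Matrix (Fin 2) (Fin 2) ℤ) = !![0, 1; -1, 0] := by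
  rw [Matrix.SpecialLinearGroup.SL2_inv_expl, ModularGroup.S]
  ext i j
  fin_cases i <;> fin_cases j <;> simp

lemma mem_Gamma0_two_or_mul_mem (γ : SL(2, ℤ)) :
    γ ∈ CongruenceSubgroup.Gamma0 2 ∨ γ * ModularGroup.S⁻¹ ∈ CongruenceSubgroup.Gamma0 2 ∨
      γ * ModularGroup.T⁻¹ * ModularGroup.S⁻¹ ∈ CongruenceSubgroup.Gamma0 2 := by
  have hS : (γ * ModularGroup.S⁻¹) 1 0 = -γ 1 1 := by
    rw [Matrix.SpecialLinearGroup.coe_mul, coe_S_inv]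
    simp [Matrix.mul_apply]
  have hST : (γ * ModularGroup.T⁻¹ * ModularGroup.S⁻¹) 1 0 = γ 1 0 - γ 1 1 := by
    rw [Matrix.SpecialLinearGroup.coe_mul, Matrix.SpecialLinearGroup.coe_mul, coe_S_inv,
      ModularGroup.coe_T_inv]
    simp [Matrix.mul_apply]
    ring
  rw [mem_Gamma0_two_iff, mem_Gamma0_two_iff, mem_Gamma0_two_iff, hS, hST, even_neg, Int.even_sub]
  tauto

lemma forall_slash_of_forall_slash_T {k : ℤ} {f : ℍ → ℂ} {p : (ℍ → ℂ) → Prop}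
    (hf : ∀ γ ∈ CongruenceSubgroup.Gamma0 2, f ∣[k] γ = f)
    (hT : ∀ g, p g → p (g ∣[k] ModularGroup.T)) (hinfty : p f)
    (hzero : p (f ∣[k] ModularGroup.S)) (γ : SL(2, ℤ)) : p (f ∣[k] γ) := by
  rcases mem_Gamma0_two_or_mul_mem γ with h | h | h
  · rwa [hf γ h]
  · rw [← hf _ h, ← SlashAction.slash_mul] at hzero
    simpa only [inv_mul_cancel_right] using hzero
  · have hzeroT := hT _ hzero
    rw [← hf _ h, ← SlashAction.slash_mul, ← SlashAction.slash_mul] at hzeroT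
    simpa only [← mul_assoc, inv_mul_cancel_right] using hzeroT

section ModularForms

variable {k : ℤ} {f : ℍ → ℂ} (hm : MDiff f)
  (hf : ∀ γ ∈ CongruenceSubgroup.Gamma0 2, f ∣[k] γ = f)

include hm hf

lemma exists_modularForm (hinfty : IsBoundedAtImInfty f)
    (hzero : IsBoundedAtImInfty (f ∣[k] ModularGroup.S)) :
    ∃ F : ModularForm ((CongruenceSubgroup.Gamma0 2).map (Matrix.SpecialLinearGroup.mapGL ℝ)) k,
      (F : ℍ → ℂ) = f := by
  refine ⟨⟨⟨f, ?_⟩, hm, fun {c} hc ↦ ?_⟩, rfl⟩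
  · rintro _ ⟨γ, hγ, rfl⟩
    exact hf γ hγ
  · rw [Subgroup.IsArithmetic.isCusp_iff_isCusp_SL2Z] at hc
    rw [OnePoint.isBoundedAt_iff_forall_SL2Z hc]
    refine fun γ _ ↦ forall_slash_of_forall_slash_T hf (fun g hg ↦ ?_) hinfty hzero γ
    exact hg.slash k (by simp [Matrix.SpecialLinearGroup.mapGL_coe_matrix, ModularGroup.coe_T])

lemma exists_cuspForm (hinfty : IsZeroAtImInfty f)
    (hzero : IsZeroAtImInfty (f ∣[k] ModularGroup.S)) :
    ∃ F : CuspForm ((CongruenceSubgroup.Gamma0 2).map (Matrix.SpecialLinearGroup.mapGL ℝ)) k,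
      (F : ℍ → ℂ) = f := by
  refine ⟨⟨⟨f, ?_⟩, hm, fun {c} hc ↦ ?_⟩, rfl⟩
  · rintro _ ⟨γ, hγ, rfl⟩
    exact hf γ hγ
  · rw [Subgroup.IsArithmetic.isCusp_iff_isCusp_SL2Z] at hc
    rw [OnePoint.isZeroAt_iff_forall_SL2Z hc]
    refine fun γ _ ↦ forall_slash_of_forall_slash_T hf (fun g hg ↦ ?_) hinfty hzero γ
    exact hg.slash k (by simp [Matrix.SpecialLinearGroup.mapGL_coe_matrix, ModularGroup.coe_T])

end ModularForms

section Periodicity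

lemma periodic_comp_ofComplex_of_vadd {f : ℍ → ℂ} {h : ℝ} (hf : ∀ τ : ℍ, f (h +ᵥ τ) = f τ) :
    Function.Periodic (f ∘ ofComplex) h := by
  intro w
  by_cases! hw : 0 < w.im
  · have hwh : 0 < (w + h).im := by simpa using hw
    simp only [Function.comp_apply, ofComplex_apply_of_im_pos hwh, ofComplex_apply_of_im_pos hw]
    rw [← hf ⟨w, hw⟩]
    congr 1
    ext
    simp [add_comm]
  · have hwh : (w + h).im ≤ 0 := by simpa using hw
    simp [ofComplex_apply_of_im_nonpos hwh, ofComplex_apply_of_im_nonpos hw]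

lemma slash_T_zpow_apply (k n : ℤ) (f : ℍ → ℂ) (τ : ℍ) :
    (f ∣[k] (ModularGroup.T ^ n)) τ = f ((n : ℝ) +ᵥ τ) := by
  rw [ModularForm.SL_slash_apply, modular_T_zpow_smul, ModularGroup.denom_apply,
    ModularGroup.coe_T_zpow]
  simp

lemma periodic_of_slash_T_zpow_eq {k n : ℤ} {f : ℍ → ℂ} (hf : f ∣[k] (ModularGroup.T ^ n) = f) :
    Function.Periodic (f ∘ ofComplex) (n : ℝ) :=
  periodic_comp_ofComplex_of_vadd fun τ ↦ by rw [← slash_T_zpow_apply k n f, hf]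

lemma T_mem_Gamma0_two : ModularGroup.T ^ (1 : ℤ) ∈ CongruenceSubgroup.Gamma0 2 := by
  rw [mem_Gamma0_two_iff, ModularGroup.coe_T_zpow]
  simp

lemma S_mul_T_sq_mul_S_inv_mem_Gamma0_two :
    ModularGroup.S * ModularGroup.T ^ (2 : ℤ) * ModularGroup.S⁻¹ ∈ CongruenceSubgroup.Gamma0 2 := by
  rw [mem_Gamma0_two_iff, Matrix.SpecialLinearGroup.coe_mul, Matrix.SpecialLinearGroup.coe_mul,
    ModularGroup.coe_T_zpow, coe_S_inv, ModularGroup.S]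
  simp [Matrix.mul_apply, Fin.sum_univ_two]

end Periodicity

/-- `f` is holomorphic and invariant of weight `k` under `Γ₀(2)`, with value `a` at the cusp `∞` and
value `b` at the cusp `0`. The value at `0` is the limit at `∞` of `f ∣[k] S`, so it depends on the
choice of `S` among the matrices carrying `∞` to `0`. -/
structure HasCuspValues (k : ℤ) (f : ℍ → ℂ) (a b : ℂ) : Prop where
  mdifferentiable : MDiff f
  slash_eq : ∀ γ ∈ CongruenceSubgroup.Gamma0 2, f ∣[k] γ = f
  tendsto_infty : Tendsto f atImInfty (𝓝 a)
  tendsto_zero : Tendsto (f ∣[k] ModularGroup.S) atImInfty (𝓝 b)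

namespace HasCuspValues

variable {k l : ℤ} {f g : ℍ → ℂ} {a b c d : ℂ}

lemma add (hf : HasCuspValues k f a b) (hg : HasCuspValues k g c d) :
    HasCuspValues k (f + g) (a + c) (b + d) where
  mdifferentiable := hf.mdifferentiable.add hg.mdifferentiable
  slash_eq γ hγ := by rw [SlashAction.add_slash, hf.slash_eq γ hγ, hg.slash_eq γ hγ]
  tendsto_infty := hf.tendsto_infty.add hg.tendsto_infty
  tendsto_zero := by
    rw [SlashAction.add_slash]
    exact hf.tendsto_zero.add hg.tendsto_zero

lemma const_smul (hf : HasCuspValues k f a b) (r : ℂ) :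
    HasCuspValues k (r • f) (r * a) (r * b) where
  mdifferentiable := hf.mdifferentiable.const_smul r
  slash_eq γ hγ := by rw [ModularForm.SL_smul_slash, hf.slash_eq γ hγ]
  tendsto_infty := hf.tendsto_infty.const_mul r
  tendsto_zero := by
    rw [ModularForm.SL_smul_slash]
    exact hf.tendsto_zero.const_mul r

lemma mul (hf : HasCuspValues k f a b) (hg : HasCuspValues l g c d) :
    HasCuspValues (k + l) (f * g) (a * c) (b * d) where
  mdifferentiable := hf.mdifferentiable.mul hg.mdifferentiable
  slash_eq γ hγ := by rw [ModularForm.mul_slash_SL2, hf.slash_eq γ hγ, hg.slash_eq γ hγ]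
  tendsto_infty := hf.tendsto_infty.mul hg.tendsto_infty
  tendsto_zero := by
    rw [ModularForm.mul_slash_SL2]
    exact hf.tendsto_zero.mul hg.tendsto_zero

lemma mdifferentiable_slash_S (hf : HasCuspValues k f a b) : MDiff (f ∣[k] ModularGroup.S) :=
  hf.mdifferentiable.slash k _

lemma serreDerivative (hf : HasCuspValues k f a b) :
    HasCuspValues (k + 2) (Derivative.serreDerivative k f) (-(k / 12) * a) (-(k / 12) * b) where
  mdifferentiable := Derivative.serreDerivative_mdifferentiable _ hf.mdifferentiable
  slash_eq γ hγ := Derivative.serreDerivative_slash_invariant hf.mdifferentiable (hf.slash_eq γ hγ)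
  tendsto_infty := tendsto_serreDerivative k hf.mdifferentiable hf.tendsto_infty
  tendsto_zero := by
    rw [Derivative.serreDerivative_slash_equivariant hf.mdifferentiable]
    exact tendsto_serreDerivative k hf.mdifferentiable_slash_S hf.tendsto_zero

lemma of_levelOne (hf : MDiff f) (hslash : ∀ γ : SL(2, ℤ), f ∣[k] γ = f)
    (ha : Tendsto f atImInfty (𝓝 a)) : HasCuspValues k f a a :=
  ⟨hf, fun γ _ ↦ hslash γ, ha, by rwa [hslash]⟩

lemma comp_posTwo_smul (hf : MDiff f) (hslash : ∀ γ : SL(2, ℤ), f ∣[k] γ = f)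
    (ha : Tendsto f atImInfty (𝓝 a)) :
    HasCuspValues k (fun τ ↦ f (posTwo • τ)) a (2 ^ (-k) * a) where
  mdifferentiable := mdifferentiable_comp_pos_real_smul posTwo hf
  slash_eq γ hγ := by
    obtain ⟨γ', -, h⟩ := exists_pos_real_smul_smul_eq (c := posTwo) rfl hγ
    ext τ
    rw [ModularForm.SL_slash_apply, (h τ).1, ← (h τ).2, ← ModularForm.SL_slash_apply, hslash]
  tendsto_infty := ha.comp (tendsto_pos_real_smul posTwo)
  tendsto_zero := by
    rw [slash_S_comp_pos_real_smul, hslash]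
    exact (ha.comp (tendsto_pos_real_smul posTwo⁻¹)).const_mul _

lemma exists_modularForm (hf : HasCuspValues k f a b) :
    ∃ F : ModularForm ((CongruenceSubgroup.Gamma0 2).map (Matrix.SpecialLinearGroup.mapGL ℝ)) k,
      (F : ℍ → ℂ) = f :=
  GammaZeroTwo.exists_modularForm hf.mdifferentiable hf.slash_eq (hf.tendsto_infty.isBigO_one ℝ)
    (hf.tendsto_zero.isBigO_one ℝ)

lemma exists_cuspForm (hf : HasCuspValues k f 0 0) :
    ∃ F : CuspForm ((CongruenceSubgroup.Gamma0 2).map (Matrix.SpecialLinearGroup.mapGL ℝ)) k,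
      (F : ℍ → ℂ) = f :=
  GammaZeroTwo.exists_cuspForm hf.mdifferentiable hf.slash_eq hf.tendsto_infty hf.tendsto_zero

lemma periodic (hf : HasCuspValues k f a b) : Function.Periodic (f ∘ ofComplex) (1 : ℝ) := by
  exact_mod_cast periodic_of_slash_T_zpow_eq (hf.slash_eq _ T_mem_Gamma0_two)

lemma periodic_slash_S (hf : HasCuspValues k f a b) :
    Function.Periodic ((f ∣[k] ModularGroup.S) ∘ ofComplex) (2 : ℝ) := by
  have h : (f ∣[k] ModularGroup.S) ∣[k] (ModularGroup.T ^ (2 : ℤ)) = f ∣[k] ModularGroup.S := by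
    nth_rw 2 [← hf.slash_eq _ S_mul_T_sq_mul_S_inv_mem_Gamma0_two]
    rw [← SlashAction.slash_mul, ← SlashAction.slash_mul, inv_mul_cancel_right]
  exact_mod_cast periodic_of_slash_T_zpow_eq h

lemma isBigO_exp (hf : HasCuspValues k f 0 b) :
    f =O[atImInfty] fun τ ↦ Real.exp (-2 * Real.pi * τ.im) := by
  simpa only [div_one] using IsZeroAtImInfty.exp_decay_atImInfty hf.tendsto_infty one_pos
    hf.periodic hf.mdifferentiable (hf.tendsto_infty.isBigO_one ℝ)

lemma slash_S_isBigO_exp (hf : HasCuspValues k f a 0) :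
    (f ∣[k] ModularGroup.S) =O[atImInfty] fun τ ↦ Real.exp (-2 * Real.pi * τ.im / 2) :=
  IsZeroAtImInfty.exp_decay_atImInfty hf.tendsto_zero two_pos hf.periodic_slash_S
    hf.mdifferentiable_slash_S (hf.tendsto_zero.isBigO_one ℝ)

end HasCuspValues

/-- `Δ(τ) Δ(2τ)`, a cusp form of weight `24` on `Γ₀(2)` with exactly a triple zero at each cusp: in
terms of the local parameters it is `q · q² = q³` at `∞`, and `q · q^(1/2) = (q^(1/2))³` at `0`. -/
def discriminantProd (τ : ℍ) : ℂ :=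
  ModularForm.discriminant τ * ModularForm.discriminant (posTwo • τ)

lemma discriminantProd_ne_zero (τ : ℍ) : discriminantProd τ ≠ 0 :=
  mul_ne_zero (ModularForm.discriminant_ne_zero _) (ModularForm.discriminant_ne_zero _)

lemma discriminant_slash (γ : SL(2, ℤ)) :
    ModularForm.discriminant ∣[(12 : ℤ)] γ = ModularForm.discriminant :=
  CuspForm.discriminant.slash_action_eq' _ ⟨γ, rfl⟩

lemma hasCuspValues_discriminantProd : HasCuspValues 24 discriminantProd 0 0 := by
  have h := (HasCuspValues.of_levelOne CuspForm.discriminant.holo' discriminant_slash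
    ModularForm.discriminant_isZeroAtImInfty).mul (HasCuspValues.comp_posTwo_smul
      CuspForm.discriminant.holo' discriminant_slash ModularForm.discriminant_isZeroAtImInfty)
  simp only [mul_zero] at h
  exact h

lemma exp_isBigO_discriminantProd :
    (fun τ ↦ Real.exp (-2 * Real.pi * τ.im) ^ 3) =O[atImInfty] discriminantProd := by
  have h := ModularForm.exp_isBigO_discriminant
  refine (h.mul (h.comp_tendsto (tendsto_pos_real_smul posTwo))).congr_left fun τ ↦ ?_
  rw [Function.comp_apply, ← Real.exp_add, ← Real.exp_nat_mul, pos_real_im]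
  simp only [posTwo, Nat.cast_ofNat]
  ring_nf

lemma exp_isBigO_discriminantProd_slash_S :
    (fun τ ↦ Real.exp (-2 * Real.pi * τ.im / 2) ^ 3) =O[atImInfty]
      (discriminantProd ∣[(24 : ℤ)] ModularGroup.S) := by
  have hslash : discriminantProd ∣[(24 : ℤ)] ModularGroup.S = fun τ ↦
      ModularForm.discriminant τ * (2 ^ (-12 : ℤ) * ModularForm.discriminant (posTwo⁻¹ • τ)) := by
    have h := ModularForm.mul_slash_SL2 12 12 ModularGroup.S ModularForm.discriminant
      fun τ ↦ ModularForm.discriminant (posTwo • τ)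
    rw [slash_S_comp_pos_real_smul, discriminant_slash] at h
    exact h
  have h := ModularForm.exp_isBigO_discriminant
  rw [hslash]
  refine (h.mul ((h.comp_tendsto (tendsto_pos_real_smul posTwo⁻¹)).const_mul_right
    (zpow_ne_zero (-12) two_ne_zero))).congr_left fun τ ↦ ?_
  rw [Function.comp_apply, ← Real.exp_add, ← Real.exp_nat_mul, pos_real_im, Positive.coe_inv]
  simp only [posTwo, Nat.cast_ofNat]
  ring_nf

/-- The quotient of the cube of `f` by `discriminantProd` is a modular form of negative weight. -/
theorem HasCuspValues.eq_zero {k : ℤ} {f : ℍ → ℂ} (hf : HasCuspValues k f 0 0) (hk : k < 8) :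
    f = 0 := by
  have hcube := (hf.mul hf).mul hf
  have hprod := hasCuspValues_discriminantProd
  have hinfty : (f * f * f) =O[atImInfty] discriminantProd :=
    (((hf.isBigO_exp.mul hf.isBigO_exp).mul hf.isBigO_exp).congr_right fun τ ↦ by ring).trans
      exp_isBigO_discriminantProd
  have hzero : ((f * f * f) ∣[k + k + k] ModularGroup.S) =O[atImInfty]
      (discriminantProd ∣[(24 : ℤ)] ModularGroup.S) := by
    rw [ModularForm.mul_slash_SL2, ModularForm.mul_slash_SL2]
    exact (((hf.slash_S_isBigO_exp.mul hf.slash_S_isBigO_exp).mul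
      hf.slash_S_isBigO_exp).congr_right fun τ ↦ by ring).trans exp_isBigO_discriminantProd_slash_S
  obtain ⟨F, hF⟩ := GammaZeroTwo.exists_modularForm (k := k + k + k - 24)
    (f := (f * f * f) / discriminantProd)
    (hcube.mdifferentiable.div hprod.mdifferentiable discriminantProd_ne_zero)
    (fun γ hγ ↦ by rw [ModularForm.div_slash_SL2, hcube.slash_eq γ hγ, hprod.slash_eq γ hγ])
    ((Asymptotics.div_isBoundedUnder_of_isBigO hinfty).isBigO_one ℝ)
    (by
      rw [ModularForm.div_slash_SL2]
      exact (Asymptotics.div_isBoundedUnder_of_isBigO hzero).isBigO_one ℝ)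
  rw [F.isZero_of_neg_weight (by omega)] at hF
  ext τ
  have hτ := (div_eq_zero_iff.mp (congrFun hF τ).symm).resolve_right (discriminantProd_ne_zero τ)
  simpa using hτ

lemma two_mul_logDerivDenom_posTwo_smul {γ γ' : SL(2, ℤ)} (h10 : (2 : ℕ) * γ' 1 0 = γ 1 0) {τ : ℍ}
    (hdenom : denom γ' (posTwo • τ : ℍ) = denom γ τ) :
    2 * logDerivDenom γ' (posTwo • τ) = logDerivDenom γ τ := by
  rw [logDerivDenom, logDerivDenom, hdenom, ← h10]
  push_cast
  ring

lemma Pt_slash_Gamma0 {γ : SL(2, ℤ)} (hγ : γ ∈ CongruenceSubgroup.Gamma0 2) :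
    Pt ∣[(2 : ℤ)] γ = Pt := by
  obtain ⟨γ', h10, h⟩ := exists_pos_real_smul_smul_eq (c := posTwo) rfl hγ
  ext τ
  have hE2 := congrFun (E2_slash γ) τ
  have hE2' := congrFun (E2_slash γ') (posTwo • τ)
  have hlog := two_mul_logDerivDenom_posTwo_smul h10 (h τ).2
  rw [ModularForm.SL_slash_apply] at hE2 hE2' ⊢
  rw [(h τ).2] at hE2'
  simp only [Pi.add_apply, Pi.smul_apply, smul_eq_mul] at hE2 hE2'
  simp only [Pt_eq_E2, (h τ).1]
  linear_combination 2 * hE2' - hE2 + 12 * hlog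

lemma logDerivDenom_S_inv_posTwo_smul (τ : ℍ) :
    logDerivDenom ModularGroup.S (posTwo⁻¹ • τ) = 2 * logDerivDenom ModularGroup.S τ := by
  rw [logDerivDenom, logDerivDenom, ModularGroup.denom_S, ModularGroup.denom_S, coe_pos_real_smul,
    Complex.real_smul, Positive.coe_inv]
  simp only [posTwo, Complex.ofReal_inv, Complex.ofReal_ofNat]
  field_simp

lemma Pt_slash_S : Pt ∣[(2 : ℤ)] ModularGroup.S = fun τ ↦
    1 / 2 * EisensteinSeries.E2 (posTwo⁻¹ • τ) - EisensteinSeries.E2 τ := by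
  have hPt : Pt = (2 : ℂ) • (fun τ : ℍ ↦ EisensteinSeries.E2 (posTwo • τ)) +
      (-1 : ℂ) • EisensteinSeries.E2 := by
    ext τ
    simp only [Pt_eq_E2, Pi.add_apply, Pi.smul_apply, smul_eq_mul]
    ring
  rw [hPt, SlashAction.add_slash, ModularForm.SL_smul_slash, ModularForm.SL_smul_slash,
    slash_S_comp_pos_real_smul, E2_slash]
  ext τ
  simp only [Pi.add_apply, Pi.smul_apply, smul_eq_mul, logDerivDenom_S_inv_posTwo_smul]
  norm_num [posTwo]
  ring

lemma hasCuspValues_Pt : HasCuspValues 2 Pt 1 (-1 / 2) where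
  mdifferentiable := by
    rw [Pt_eq_E2]
    exact ((mdifferentiable_comp_pos_real_smul posTwo E2_mdifferentiable).const_smul (2 : ℂ)).sub
      E2_mdifferentiable
  slash_eq _ := Pt_slash_Gamma0
  tendsto_infty := by
    have h := ((tendsto_E2.comp (tendsto_pos_real_smul posTwo)).const_mul 2).sub tendsto_E2
    rwa [show (2 : ℂ) * 1 - 1 = 1 by norm_num, Function.comp_def, ← Pt_eq_E2] at h
  tendsto_zero := by
    have h := ((tendsto_E2.comp (tendsto_pos_real_smul posTwo⁻¹)).const_mul (1 / 2)).sub tendsto_E2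
    rwa [show (1 / 2 : ℂ) * 1 - 1 = -1 / 2 by norm_num, Function.comp_def, ← Pt_slash_S] at h

lemma E₄_slash (γ : SL(2, ℤ)) : (ModularForm.E₄ : ℍ → ℂ) ∣[(4 : ℤ)] γ = ModularForm.E₄ :=
  ModularForm.E₄.slash_action_eq' _ ⟨γ, rfl⟩

lemma hasCuspValues_E₄ : HasCuspValues 4 ModularForm.E₄ 1 1 :=
  HasCuspValues.of_levelOne ModularForm.E₄.holo' E₄_slash tendsto_E₄

lemma hasCuspValues_Q : HasCuspValues 4 Q 1 0 := by
  have h := ((HasCuspValues.comp_posTwo_smul ModularForm.E₄.holo' E₄_slash tendsto_E₄).const_smul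
    (16 / 15)).add (hasCuspValues_E₄.const_smul (-1 / 15))
  convert h using 1
  · ext τ
    simp only [Q_eq_E₄, Pi.add_apply, Pi.smul_apply, smul_eq_mul]
    ring!
  · norm_num
  · norm_num

lemma hasCuspValues_D : HasCuspValues 4 D 0 (1 / 256) := by
  have h := ((hasCuspValues_Pt.mul hasCuspValues_Pt).const_smul (1 / 64)).add
    (hasCuspValues_Q.const_smul (-1 / 64))
  convert h using 1
  · norm_num
  · ext τ
    simp only [D, Pi.add_apply, Pi.smul_apply, Pi.mul_apply, smul_eq_mul]
    ring
  · norm_num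
  · norm_num

lemma hasCuspValues_Dt : HasCuspValues 8 Dt 0 0 := by
  have h := hasCuspValues_D.mul hasCuspValues_Q
  rwa [zero_mul, mul_zero] at h

lemma HasCuspValues.eq_of_weight_lt_eight {k : ℤ} {f g : ℍ → ℂ} {a b c d : ℂ}
    (hf : HasCuspValues k f a b) (hg : HasCuspValues k g c d) (hk : k < 8) (hinfty : a = c)
    (hzero : b = d) : f = g := by
  have h := hf.add (hg.const_smul (-1))
  rw [hinfty, hzero, neg_one_mul, neg_one_mul, add_neg_cancel, add_neg_cancel, neg_one_smul,
    ← sub_eq_add_neg] at h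
  exact sub_eq_zero.mp (h.eq_zero hk)

lemma E₄_eq_Pt_Q (τ : ℍ) : ModularForm.E₄ τ = 4 * Pt τ ^ 2 - 3 * Q τ := by
  have h : (ModularForm.E₄ : ℍ → ℂ) = (4 : ℂ) • (Pt * Pt) + (-3 : ℂ) • Q :=
    hasCuspValues_E₄.eq_of_weight_lt_eight (((hasCuspValues_Pt.mul hasCuspValues_Pt).const_smul
      4).add (hasCuspValues_Q.const_smul (-3))) (by norm_num) (by norm_num) (by norm_num)
  have hτ := congrFun h τ
  simp only [Pi.add_apply, Pi.smul_apply, Pi.mul_apply, smul_eq_mul] at hτ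
  linear_combination hτ

lemma serreDerivative_Pt (τ : ℍ) :
    Derivative.serreDerivative 2 Pt τ = Pt τ ^ 2 / 3 - Q τ / 2 := by
  have h : Derivative.serreDerivative 2 Pt = (1 / 3 : ℂ) • (Pt * Pt) + (-1 / 2 : ℂ) • Q :=
    hasCuspValues_Pt.serreDerivative.eq_of_weight_lt_eight (((hasCuspValues_Pt.mul
      hasCuspValues_Pt).const_smul (1 / 3)).add (hasCuspValues_Q.const_smul (-1 / 2)))
      (by norm_num) (by norm_num) (by norm_num)
  have hτ := congrFun h τ
  simp only [Pi.add_apply, Pi.smul_apply, Pi.mul_apply, smul_eq_mul] at hτ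
  linear_combination hτ

lemma serreDerivative_Q (τ : ℍ) :
    Derivative.serreDerivative 4 Q τ = -(Pt τ * Q τ) / 3 := by
  have h : Derivative.serreDerivative 4 Q = (-1 / 3 : ℂ) • (Pt * Q) :=
    hasCuspValues_Q.serreDerivative.eq_of_weight_lt_eight ((hasCuspValues_Pt.mul
      hasCuspValues_Q).const_smul (-1 / 3)) (by norm_num) (by norm_num) (by norm_num)
  have hτ := congrFun h τ
  simp only [Pi.smul_apply, Pi.mul_apply, smul_eq_mul] at hτ
  linear_combination hτ

/-- `E₂' - (E₂² - E₄) / 12`, where `' = q d/dq`; Ramanujan's identity says that it vanishes. -/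
def ramanujanDefect : ℍ → ℂ :=
  dq EisensteinSeries.E2 + ((-1 / 12 : ℂ) • (EisensteinSeries.E2 * EisensteinSeries.E2) +
    (1 / 12 : ℂ) • (ModularForm.E₄ : ℍ → ℂ))

lemma dq_E2_slash (γ : SL(2, ℤ)) : dq EisensteinSeries.E2 ∣[(4 : ℤ)] γ =
    dq EisensteinSeries.E2 + (2 : ℂ) • (logDerivDenom γ * EisensteinSeries.E2) +
      (12 : ℂ) • logDerivDenom γ ^ 2 := by
  have h := dq_slash 2 E2_mdifferentiable γ
  rw [E2_slash, dq, dq, Derivative.normalizedDerivOfComplex_add _ _ E2_mdifferentiable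
    ((mdifferentiable_logDerivDenom γ).const_smul _),
    Derivative.normalizedDerivOfComplex_smul _ _ (mdifferentiable_logDerivDenom γ)] at h
  refine h.trans ?_
  ext τ
  have hτ := congrFun (dq_logDerivDenom γ) τ
  simp only [Pi.add_apply, Pi.smul_apply, Pi.mul_apply, Pi.pow_apply, Pi.neg_apply,
    smul_eq_mul] at hτ ⊢
  push_cast
  linear_combination 12 * hτ

lemma ramanujanDefect_slash (γ : SL(2, ℤ)) : ramanujanDefect ∣[(4 : ℤ)] γ = ramanujanDefect := by
  have hsq : (EisensteinSeries.E2 * EisensteinSeries.E2) ∣[(4 : ℤ)] γ =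
      (EisensteinSeries.E2 ∣[(2 : ℤ)] γ) * (EisensteinSeries.E2 ∣[(2 : ℤ)] γ) :=
    ModularForm.mul_slash_SL2 2 2 γ EisensteinSeries.E2 EisensteinSeries.E2
  rw [ramanujanDefect, SlashAction.add_slash, SlashAction.add_slash, ModularForm.SL_smul_slash,
    ModularForm.SL_smul_slash, E₄_slash, hsq, E2_slash, dq_E2_slash]
  ext τ
  simp only [Pi.add_apply, Pi.smul_apply, Pi.mul_apply, Pi.pow_apply, smul_eq_mul]
  ring

lemma hasCuspValues_ramanujanDefect : HasCuspValues 4 ramanujanDefect 0 0 := by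
  refine .of_levelOne ?_ ramanujanDefect_slash ?_
  · exact (Derivative.normalizedDerivOfComplex_mdifferentiable E2_mdifferentiable).add
      (((E2_mdifferentiable.mul E2_mdifferentiable).const_smul _).add
        (ModularForm.E₄.holo'.const_smul _))
  · have h := (tendsto_dq_zero E2_mdifferentiable tendsto_E2).add
      (((tendsto_E2.mul tendsto_E2).const_mul (-1 / 12)).add (tendsto_E₄.const_mul (1 / 12)))
    rwa [show (0 : ℂ) + (-1 / 12 * (1 * 1) + 1 / 12 * 1) = 0 by norm_num] at h

theorem dq_E2 (τ : ℍ) : dq EisensteinSeries.E2 τ =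
    (EisensteinSeries.E2 τ ^ 2 - ModularForm.E₄ τ) / 12 := by
  have hτ := congrFun (hasCuspValues_ramanujanDefect.eq_zero (by norm_num)) τ
  simp only [ramanujanDefect, Pi.add_apply, Pi.smul_apply, Pi.mul_apply, smul_eq_mul,
    Pi.zero_apply] at hτ
  linear_combination hτ

/-- `f` is holomorphic and its covariant derivative `∂ₖ f = f' - (k/4) P f` is `g`. As `P / 4`
transforms like `E₂ / 12`, this derivation raises weights on `Γ₀(2)` by `2`. -/
def HasCovDeriv (k : ℂ) (f g : ℍ → ℂ) : Prop :=
  MDiff f ∧ ∀ τ, dq f τ = k / 4 * P τ * f τ + g τ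

namespace HasCovDeriv

variable {k l : ℂ} {f f' g g' : ℍ → ℂ}

lemma congr (hf : HasCovDeriv k f f') (hk : k = l) (h : ∀ τ, f' τ = g' τ) :
    HasCovDeriv l f g' :=
  ⟨hf.1, fun τ ↦ by rw [hf.2, hk, h]⟩

lemma zero (k : ℂ) : HasCovDeriv k (fun _ ↦ 0) fun _ ↦ 0 :=
  ⟨mdifferentiable_const, fun τ ↦ by
    rw [dq, Derivative.normalizedDerivOfComplex_const, Pi.zero_apply, mul_zero, add_zero]⟩

lemma add (hf : HasCovDeriv k f f') (hg : HasCovDeriv k g g') :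
    HasCovDeriv k (fun τ ↦ f τ + g τ) fun τ ↦ f' τ + g' τ := by
  refine ⟨hf.1.add hg.1, fun τ ↦ ?_⟩
  have h : dq (fun τ ↦ f τ + g τ) τ = dq f τ + dq g τ :=
    congrFun (Derivative.normalizedDerivOfComplex_add f g hf.1 hg.1) τ
  rw [h, hf.2, hg.2]
  ring

lemma const_mul (c : ℂ) (hf : HasCovDeriv k f f') :
    HasCovDeriv k (fun τ ↦ c * f τ) fun τ ↦ c * f' τ := by
  refine ⟨hf.1.const_smul c, fun τ ↦ ?_⟩
  have h : dq (fun τ ↦ c * f τ) τ = c * dq f τ :=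
    congrFun (Derivative.normalizedDerivOfComplex_smul c f hf.1) τ
  rw [h, hf.2]
  ring

lemma mul (hf : HasCovDeriv k f f') (hg : HasCovDeriv l g g') :
    HasCovDeriv (k + l) (fun τ ↦ f τ * g τ) fun τ ↦ f' τ * g τ + f τ * g' τ := by
  refine ⟨hf.1.mul hg.1, fun τ ↦ ?_⟩
  have h : dq (fun τ ↦ f τ * g τ) τ = dq f τ * g τ + f τ * dq g τ :=
    congrFun (Derivative.normalizedDerivOfComplex_mul f g hf.1 hg.1) τ
  rw [h, hf.2, hg.2]
  ring

end HasCovDeriv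

lemma hasCovDeriv_Pt : HasCovDeriv 2 Pt fun τ ↦ -1 / 2 * Q τ := by
  refine ⟨hasCuspValues_Pt.mdifferentiable, fun τ ↦ ?_⟩
  have h : dq Pt τ - 2 * 12⁻¹ * EisensteinSeries.E2 τ * Pt τ = _ := serreDerivative_Pt τ
  linear_combination h - 1 / 2 * Pt τ * P_eq_E2 τ

lemma hasCovDeriv_Q : HasCovDeriv 4 Q fun τ ↦ -1 * (Pt τ * Q τ) := by
  refine ⟨hasCuspValues_Q.mdifferentiable, fun τ ↦ ?_⟩
  have h : dq Q τ - 4 * 12⁻¹ * EisensteinSeries.E2 τ * Q τ = _ := serreDerivative_Q τ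
  linear_combination h - Q τ * P_eq_E2 τ

lemma hasCovDeriv_P : HasCovDeriv 2 P fun τ ↦ -1 / 4 * (P τ ^ 2 + Q τ) := by
  have hP : P = (1 / 3 : ℂ) • EisensteinSeries.E2 + (2 / 3 : ℂ) • Pt := by
    ext τ
    simp only [P_eq_E2 τ, Pi.add_apply, Pi.smul_apply, smul_eq_mul]
    ring
  have hE2 := E2_mdifferentiable.const_smul (1 / 3 : ℂ)
  have hPt := hasCuspValues_Pt.mdifferentiable.const_smul (2 / 3 : ℂ)
  refine ⟨hP ▸ hE2.add hPt, fun τ ↦ ?_⟩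
  have h : dq P τ = 1 / 3 * dq EisensteinSeries.E2 τ + 2 / 3 * dq Pt τ := by
    rw [hP, dq, Derivative.normalizedDerivOfComplex_add _ _ hE2 hPt,
      Derivative.normalizedDerivOfComplex_smul _ _ E2_mdifferentiable,
      Derivative.normalizedDerivOfComplex_smul _ _ hasCuspValues_Pt.mdifferentiable]
    rfl
  simp only [h, dq_E2, hasCovDeriv_Pt.2, E₄_eq_Pt_Q, P_eq_E2]
  ring

lemma hasCovDeriv_D : HasCovDeriv 4 D fun _ ↦ 0 := by
  have hsq := (hasCovDeriv_Pt.mul hasCovDeriv_Pt).const_mul (1 / 64)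
  have hQ := hasCovDeriv_Q.const_mul (-1 / 64)
  have hD : D = fun τ ↦ 1 / 64 * (Pt τ * Pt τ) + -1 / 64 * Q τ := by
    ext τ
    rw [D]
    ring
  rw [hD]
  exact ((hsq.congr (by norm_num) fun _ ↦ rfl).add hQ).congr rfl fun τ ↦ by ring

lemma hasCovDeriv_Dt : HasCovDeriv 8 Dt fun τ ↦ -1 * (Pt τ * Dt τ) :=
  (hasCovDeriv_D.mul hasCovDeriv_Q).congr (by norm_num) fun τ ↦ by
    rw [Dt]
    ring

/-- `aₙ` is the `n`-th canonical covariant derivative of `f` (with `a₀ = f`), defined by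
`∂ aₙ = aₙ₊₁ + n (n + k - 1) / 16 * Q aₙ₋₁`. The last term absorbs the `Q` in
`P' = (P² - Q) / 4`, so that the derivatives of `f` are polynomials in `P`, `a₀`, …, `a₄`. -/
structure CovariantJet (k : ℂ) (f a₁ a₂ a₃ a₄ : ℍ → ℂ) : Prop where
  one : HasCovDeriv k f a₁
  two : HasCovDeriv (k + 2) a₁ fun τ ↦ a₂ τ + k / 16 * (Q τ * f τ)
  three : HasCovDeriv (k + 4) a₂ fun τ ↦ a₃ τ + (k + 1) / 8 * (Q τ * a₁ τ)
  four : HasCovDeriv (k + 6) a₃ fun τ ↦ a₄ τ + 3 * (k + 2) / 16 * (Q τ * a₂ τ)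

namespace CovariantJet

variable {k : ℂ} {f a₁ a₂ a₃ a₄ : ℍ → ℂ}

lemma dq_eq (h : CovariantJet k f a₁ a₂ a₃ a₄) :
    dq f = fun τ ↦ k / 4 * (P τ * f τ) + a₁ τ := by
  ext τ
  rw [h.one.2, mul_assoc]

lemma dq_dq_eq (h : CovariantJet k f a₁ a₂ a₃ a₄) :
    dq (dq f) = fun τ ↦ k * (k + 1) / 16 * (P τ * (P τ * f τ)) + ((k + 1) / 2 * (P τ * a₁ τ)
      + a₂ τ) := by
  have hPf := ((hasCovDeriv_P.mul h.one).const_mul (k / 4)).congr (add_comm 2 k) fun _ ↦ rfl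
  ext τ
  rw [h.dq_eq, (hPf.add h.two).2]
  ring

lemma dq_dq_dq_eq (h : CovariantJet k f a₁ a₂ a₃ a₄) :
    dq (dq (dq f)) = fun τ ↦ k * (k + 1) * (k + 2) / 64 * (P τ * (P τ * (P τ * f τ)))
      + (3 * (k + 1) * (k + 2) / 16 * (P τ * (P τ * a₁ τ)) + (3 * (k + 2) / 4 * (P τ * a₂ τ)
      + a₃ τ)) := by
  have hPPf := ((hasCovDeriv_P.mul (hasCovDeriv_P.mul h.one)).const_mul (k * (k + 1) / 16)).congr
    (show _ = k + 4 by ring) fun _ ↦ rfl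
  have hPa₁ := ((hasCovDeriv_P.mul h.two).const_mul ((k + 1) / 2)).congr
    (show _ = k + 4 by ring) fun _ ↦ rfl
  ext τ
  rw [h.dq_dq_eq, (hPPf.add (hPa₁.add h.three)).2]
  ring

lemma dq_dq_dq_dq_eq (h : CovariantJet k f a₁ a₂ a₃ a₄) (τ : ℍ) :
    dq (dq (dq (dq f))) τ = k * (k + 1) * (k + 2) * (k + 3) / 256 * P τ ^ 4 * f τ
      + (k + 1) * (k + 2) * (k + 3) / 16 * P τ ^ 3 * a₁ τ
      + 3 * (k + 2) * (k + 3) / 8 * P τ ^ 2 * a₂ τ + (k + 3) * P τ * a₃ τ + a₄ τ := by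
  have hPPPf := ((hasCovDeriv_P.mul (hasCovDeriv_P.mul (hasCovDeriv_P.mul h.one))).const_mul
    (k * (k + 1) * (k + 2) / 64)).congr (show _ = k + 6 by ring) fun _ ↦ rfl
  have hPPa₁ := ((hasCovDeriv_P.mul (hasCovDeriv_P.mul h.two)).const_mul
    (3 * (k + 1) * (k + 2) / 16)).congr (show _ = k + 6 by ring) fun _ ↦ rfl
  have hPa₂ := ((hasCovDeriv_P.mul h.three).const_mul (3 * (k + 2) / 4)).congr
    (show _ = k + 6 by ring) fun _ ↦ rfl
  rw [h.dq_dq_dq_eq, (hPPPf.add (hPPa₁.add (hPa₂.add h.four))).2]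
  ring

lemma covB_eq (h : CovariantJet k f a₁ a₂ a₃ a₄) (τ : ℍ) :
    covB k f τ = k * f τ * a₂ τ - (k + 1) * a₁ τ ^ 2 := by
  rw [covB, h.dq_dq_eq, h.dq_eq]
  ring

lemma covA_eq (h : CovariantJet k f a₁ a₂ a₃ a₄) (τ : ℍ) :
    covA k f τ = k ^ 2 * f τ ^ 2 * a₃ τ - 3 * k * (k + 2) * f τ * a₁ τ * a₂ τ
      + 2 * (k + 1) * (k + 2) * a₁ τ ^ 3 := by
  rw [covA, h.dq_dq_dq_eq, h.dq_dq_eq, h.dq_eq]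
  ring

lemma covC_eq (h : CovariantJet k f a₁ a₂ a₃ a₄) (τ : ℍ) :
    covC k f τ = k * (k + 1) * f τ * a₄ τ - 4 * (k + 1) * (k + 3) * a₁ τ * a₃ τ
      + 3 * (k + 2) * (k + 3) * a₂ τ ^ 2 := by
  rw [covC, h.dq_dq_dq_dq_eq, h.dq_dq_dq_eq, h.dq_dq_eq, h.dq_eq]
  ring

end CovariantJet

lemma covariantJet_Pt : CovariantJet 2 Pt (fun τ ↦ -1 / 2 * Q τ)
    (fun τ ↦ 3 / 8 * (Pt τ * Q τ)) (fun τ ↦ -3 / 8 * (Pt τ * (Pt τ * Q τ)))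
    (fun τ ↦ 3 / 8 * Pt τ ^ 3 * Q τ + 3 / 32 * Pt τ * Q τ ^ 2) where
  one := hasCovDeriv_Pt
  two := (hasCovDeriv_Q.const_mul _).congr (by norm_num) fun τ ↦ by ring
  three := ((hasCovDeriv_Pt.mul hasCovDeriv_Q).const_mul _).congr (by norm_num) fun τ ↦ by ring
  four := ((hasCovDeriv_Pt.mul (hasCovDeriv_Pt.mul hasCovDeriv_Q)).const_mul _).congr
    (by norm_num) fun τ ↦ by ring

lemma covariantJet_Q : CovariantJet 4 Q (fun τ ↦ -1 * (Pt τ * Q τ))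
    (fun τ ↦ Pt τ * (Pt τ * Q τ) + 1 / 4 * (Q τ * Q τ))
    (fun τ ↦ -1 * (Pt τ * (Pt τ * (Pt τ * Q τ))) + -7 / 8 * (Pt τ * (Q τ * Q τ)))
    (fun τ ↦ Pt τ ^ 4 * Q τ + 17 / 8 * Pt τ ^ 2 * Q τ ^ 2 + 5 / 32 * Q τ ^ 3) where
  one := hasCovDeriv_Q
  two := ((hasCovDeriv_Pt.mul hasCovDeriv_Q).const_mul _).congr (by norm_num) fun τ ↦ by ring
  three := by
    have hPPQ := (hasCovDeriv_Pt.mul (hasCovDeriv_Pt.mul hasCovDeriv_Q)).congr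
      (show _ = (4 + 4 : ℂ) by norm_num) fun _ ↦ rfl
    exact (hPPQ.add ((hasCovDeriv_Q.mul hasCovDeriv_Q).const_mul _)).congr rfl fun τ ↦ by ring
  four := by
    have hPPPQ := ((hasCovDeriv_Pt.mul (hasCovDeriv_Pt.mul (hasCovDeriv_Pt.mul
      hasCovDeriv_Q))).const_mul (-1)).congr (show _ = (4 + 6 : ℂ) by norm_num) fun _ ↦ rfl
    have hPQQ := ((hasCovDeriv_Pt.mul (hasCovDeriv_Q.mul hasCovDeriv_Q)).const_mul
      (-7 / 8)).congr (show _ = (4 + 6 : ℂ) by norm_num) fun _ ↦ rfl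
    exact (hPPPQ.add hPQQ).congr rfl fun τ ↦ by ring

lemma covariantJet_D : CovariantJet 4 D (fun _ ↦ 0) (fun τ ↦ -1 / 4 * (Q τ * D τ))
    (fun τ ↦ 1 / 4 * (Pt τ * (Q τ * D τ)))
    (fun τ ↦ 5 / 32 * Q τ ^ 2 * D τ - 1 / 4 * Pt τ ^ 2 * Q τ * D τ) where
  one := hasCovDeriv_D
  two := (HasCovDeriv.zero _).congr rfl fun τ ↦ by ring
  three := ((hasCovDeriv_Q.mul hasCovDeriv_D).const_mul _).congr (by norm_num) fun τ ↦ by ring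
  four := ((hasCovDeriv_Pt.mul (hasCovDeriv_Q.mul hasCovDeriv_D)).const_mul _).congr
    (by norm_num) fun τ ↦ by ring

lemma covariantJet_Dt : CovariantJet 8 Dt (fun τ ↦ -1 * (Pt τ * Dt τ))
    (fun τ ↦ Pt τ * (Pt τ * Dt τ))
    (fun τ ↦ -1 * (Pt τ * (Pt τ * (Pt τ * Dt τ))) + 1 / 8 * (Pt τ * (Q τ * Dt τ)))
    (fun τ ↦ Dt τ * (Pt τ ^ 4 - 5 / 8 * Pt τ ^ 2 * Q τ - 1 / 16 * Q τ ^ 2)) where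
  one := hasCovDeriv_Dt
  two := ((hasCovDeriv_Pt.mul hasCovDeriv_Dt).const_mul _).congr (by norm_num) fun τ ↦ by ring
  three := (hasCovDeriv_Pt.mul (hasCovDeriv_Pt.mul hasCovDeriv_Dt)).congr (by norm_num)
    fun τ ↦ by ring
  four := by
    have hPPPDt := ((hasCovDeriv_Pt.mul (hasCovDeriv_Pt.mul (hasCovDeriv_Pt.mul
      hasCovDeriv_Dt))).const_mul (-1)).congr (show _ = (8 + 6 : ℂ) by norm_num) fun _ ↦ rfl
    have hPQDt := ((hasCovDeriv_Pt.mul (hasCovDeriv_Q.mul hasCovDeriv_Dt)).const_mul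
      (1 / 8)).congr (show _ = (8 + 6 : ℂ) by norm_num) fun _ ↦ rfl
    exact (hPPPDt.add hPQDt).congr rfl fun τ ↦ by ring

lemma covariant_relation_Pt (τ : ℍ) :
    covA 2 Pt τ ^ 2 + 64 / 3 * covB 2 Pt τ ^ 3 - 4 * Pt τ ^ 4 * covB 2 Pt τ ^ 2 = 0 := by
  rw [covariantJet_Pt.covA_eq, covariantJet_Pt.covB_eq]
  ring

lemma covariant_relation_Q (τ : ℍ) :
    covA 4 Q τ ^ 2 + 16 * covB 4 Q τ ^ 3 - 16 * Q τ ^ 3 * covB 4 Q τ ^ 2 = 0 := by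
  rw [covariantJet_Q.covA_eq, covariantJet_Q.covB_eq]
  ring

lemma covariant_relation_D (τ : ℍ) :
    covA 4 D τ ^ 2 + 16 * covB 4 D τ ^ 3 - 1024 * D τ ^ 3 * covB 4 D τ ^ 2 = 0 := by
  rw [covariantJet_D.covA_eq, covariantJet_D.covB_eq, D]
  ring

lemma covariant_relation_Dt (τ : ℍ) :
    covA 8 Dt τ ^ 2 + 16 * covB 8 Dt τ ^ 3 - 4096 * Dt τ ^ 5 * covB 8 Dt τ = 0 := by
  rw [covariantJet_Dt.covA_eq, covariantJet_Dt.covB_eq, Dt, D]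
  ring

lemma satisfiesLinearPQ_of_cleared {k a b c : ℂ} {f : ℍ → ℂ}
    (h : ∀ τ : ℍ, a * (f τ ^ 2 * covC k f τ * covB k f τ) + b * covA k f τ ^ 2
      + c * covB k f τ ^ 3 = 0) : SatisfiesLinearPQ k a b c f := by
  refine ⟨fun τ hB ↦ ?_, h⟩
  rw [invQ, invP]
  field_simp
  linear_combination h τ

lemma satisfiesLinearPQ_Pt : SatisfiesLinearPQ 2 4 (-3) (-64) Pt :=
  satisfiesLinearPQ_of_cleared fun τ ↦ by
    rw [covariantJet_Pt.covA_eq, covariantJet_Pt.covB_eq, covariantJet_Pt.covC_eq]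
    ring

lemma satisfiesLinearPQ_Q : SatisfiesLinearPQ 4 16 (-5) (-176) Q :=
  satisfiesLinearPQ_of_cleared fun τ ↦ by
    rw [covariantJet_Q.covA_eq, covariantJet_Q.covB_eq, covariantJet_Q.covC_eq]
    ring

lemma satisfiesLinearPQ_D : SatisfiesLinearPQ 4 16 (-5) (-176) D :=
  satisfiesLinearPQ_of_cleared fun τ ↦ by
    rw [covariantJet_D.covA_eq, covariantJet_D.covB_eq, covariantJet_D.covC_eq]
    ring

lemma satisfiesLinearPQ_Dt : SatisfiesLinearPQ 8 128 (-9) (-912) Dt :=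
  satisfiesLinearPQ_of_cleared fun τ ↦ by
    rw [covariantJet_Dt.covA_eq, covariantJet_Dt.covB_eq, covariantJet_Dt.covC_eq]
    ring

lemma ode_Pt (τ : ℍ) :
    let y := Pt τ
    let y₁ := dq Pt τ
    let y₂ := dq (dq Pt) τ
    let y₃ := dq (dq (dq Pt)) τ
    3 * y ^ 2 * y₃ ^ 2 - 36 * (y * y₁ * y₂ - y₁ ^ 3) * y₃ + 32 * y * y₂ ^ 3
      - 3 * (12 * y₁ ^ 2 + y ^ 4) * y₂ ^ 2 + 9 * y ^ 3 * y₁ ^ 2 * y₂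
      - 27 / 4 * y ^ 2 * y₁ ^ 4 = 0 := by
  intro y y₁ y₂ y₃
  rw [show y₃ = _ from congrFun covariantJet_Pt.dq_dq_dq_eq τ,
    show y₂ = _ from congrFun covariantJet_Pt.dq_dq_eq τ,
    show y₁ = _ from congrFun covariantJet_Pt.dq_eq τ]
  ring

lemma ode_Q (τ : ℍ) :
    let y := Q τ
    let y₁ := dq Q τ
    let y₂ := dq (dq Q) τ
    let y₃ := dq (dq (dq Q)) τ
    4 * y ^ 4 * y₃ ^ 2 - 6 * y ^ 2 * y₁ * (6 * y * y₂ - 5 * y₁ ^ 2) * y₃ + 16 * y ^ 3 * y₂ ^ 3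
      + y ^ 2 * (21 * y₁ ^ 2 - 4 * y ^ 3) * y₂ ^ 2
      - 10 * y * y₁ ^ 2 * (6 * y₁ ^ 2 - y ^ 3) * y₂ + 25 * y₁ ^ 6
      - 25 / 4 * y ^ 3 * y₁ ^ 4 = 0 := by
  intro y y₁ y₂ y₃
  have h := covariant_relation_Q τ
  rw [covA, covB] at h
  linear_combination h / 64

lemma ode_D (τ : ℍ) :
    let y := D τ
    let y₁ := dq D τ
    let y₂ := dq (dq D) τ
    let y₃ := dq (dq (dq D)) τ
    4 * y ^ 4 * y₃ ^ 2 - 6 * y ^ 2 * y₁ * (6 * y * y₂ - 5 * y₁ ^ 2) * y₃ + 16 * y ^ 3 * y₂ ^ 3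
      - y ^ 2 * (256 * y ^ 3 - 21 * y₁ ^ 2) * y₂ ^ 2
      + 20 * y * y₁ ^ 2 * (32 * y ^ 3 - 3 * y₁ ^ 2) * y₂ + 25 * y₁ ^ 6
      - 400 * y ^ 3 * y₁ ^ 4 = 0 := by
  intro y y₁ y₂ y₃
  have h := covariant_relation_D τ
  rw [covA, covB] at h
  linear_combination h / 64

lemma ode_Dt (τ : ℍ) :
    let y := Dt τ
    let y₁ := dq Dt τ
    let y₂ := dq (dq Dt) τ
    let y₃ := dq (dq (dq Dt)) τ
    16 * y ^ 4 * y₃ ^ 2 - 30 * y ^ 2 * y₁ * (4 * y * y₂ - 3 * y₁ ^ 2) * y₃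
      + 32 * y ^ 3 * y₂ ^ 3 + 117 * y ^ 2 * y₁ ^ 2 * y₂ ^ 2
      - 8 * y * (16 * y ^ 5 + 27 * y₁ ^ 4) * y₂ + 81 * y₁ ^ 6
      + 144 * y ^ 5 * y₁ ^ 2 = 0 := by
  intro y y₁ y₂ y₃
  have h := covariant_relation_Dt τ
  rw [covA, covB] at h
  linear_combination h / 256

/-- With `e = exp (l / m)`, the three numbers `f τ`, `f^(2+4/k)` and `f^(3+6/k)` are `e ^ m`,
`e ^ (2 m + 2)` and `e ^ (3 m + 3)`. -/
lemma inv_relation_of_covariant_relation {k : ℂ} {m n j : ℕ} (hm : m ≠ 0) (hk : k = 2 * m)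
    (hn : m * n + (2 * m + 2) * j = 6 * m + 6) {b c l : ℂ} {f : ℍ → ℂ} {τ : ℍ}
    (hl : Complex.exp l = f τ)
    (h : covA k f τ ^ 2 + b * covB k f τ ^ 3 - c * f τ ^ n * covB k f τ ^ j = 0) :
    invJ k f l τ ^ 2 + b * invI k f l τ ^ 3 - c * invI k f l τ ^ j = 0 := by
  obtain ⟨e, he⟩ : ∃ e, e = Complex.exp (l / m) := ⟨_, rfl⟩
  have hm' : (m : ℂ) ≠ 0 := Nat.cast_ne_zero.mpr hm
  have he0 : e ≠ 0 := he ▸ Complex.exp_ne_zero _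
  have hf : f τ = e ^ m := by
    rw [← hl, he, ← Complex.exp_nat_mul, mul_div_cancel₀ _ hm']
  have hI : Complex.exp ((2 + 4 / k) * l) = e ^ (2 * m + 2) := by
    rw [he, hk, ← Complex.exp_nat_mul]
    congr 1
    push_cast
    field_simp
    ring
  have hJ : Complex.exp ((3 + 6 / k) * l) = e ^ (3 * m + 3) := by
    rw [he, hk, ← Complex.exp_nat_mul]
    congr 1
    push_cast
    field_simp
    ring
  have hquot : (covB k f τ / e ^ (2 * m + 2)) ^ j =
      f τ ^ n * covB k f τ ^ j / e ^ (6 * m + 6) := by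
    have hdenom : e ^ (6 * m + 6) = f τ ^ n * (e ^ (2 * m + 2)) ^ j := by
      rw [hf, ← pow_mul, ← pow_mul, ← pow_add, hn]
    rw [hdenom, div_pow, mul_div_mul_left _ _ (pow_ne_zero n (hf ▸ pow_ne_zero m he0))]
  rw [invI, invJ, hI, hJ, hquot, div_pow, div_pow, ← pow_mul, ← pow_mul,
    show (3 * m + 3) * 2 = 6 * m + 6 by ring, show (2 * m + 2) * 3 = 6 * m + 6 by ring]
  linear_combination h / e ^ (6 * m + 6)

end GammaZeroTwo

end

theorem mainTheorem7 :
    -- the system satisfied by `P`, `P̃`, `Q`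
    (MDifferentiable 𝓘(ℂ) 𝓘(ℂ) GammaZeroTwo.P ∧
      ∀ τ : ℍ,
        GammaZeroTwo.dq GammaZeroTwo.P τ = (GammaZeroTwo.P τ ^ 2 - GammaZeroTwo.Q τ) / 4 ∧
        GammaZeroTwo.dq GammaZeroTwo.Pt τ
          = (GammaZeroTwo.P τ * GammaZeroTwo.Pt τ - GammaZeroTwo.Q τ) / 2 ∧
        GammaZeroTwo.dq GammaZeroTwo.Q τ
          = (GammaZeroTwo.P τ - GammaZeroTwo.Pt τ) * GammaZeroTwo.Q τ) ∧
    -- modularity on `Γ₀(2)`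
    (∃ F : ModularForm ((CongruenceSubgroup.Gamma0 2).map (Matrix.SpecialLinearGroup.mapGL ℝ)) 2,
      (F : ℍ → ℂ) = GammaZeroTwo.Pt) ∧
    (∃ F : ModularForm ((CongruenceSubgroup.Gamma0 2).map (Matrix.SpecialLinearGroup.mapGL ℝ)) 4,
      (F : ℍ → ℂ) = GammaZeroTwo.Q) ∧
    (∃ F : ModularForm ((CongruenceSubgroup.Gamma0 2).map (Matrix.SpecialLinearGroup.mapGL ℝ)) 4,
      (F : ℍ → ℂ) = GammaZeroTwo.D) ∧
    (∃ F : CuspForm ((CongruenceSubgroup.Gamma0 2).map (Matrix.SpecialLinearGroup.mapGL ℝ)) 8,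
      (F : ℍ → ℂ) = GammaZeroTwo.Dt) ∧
    -- third-order equation for `P̃`, explicitly and in invariant form
    (∀ τ : ℍ,
      let y := GammaZeroTwo.Pt τ
      let y₁ := GammaZeroTwo.dq GammaZeroTwo.Pt τ
      let y₂ := GammaZeroTwo.dq (GammaZeroTwo.dq GammaZeroTwo.Pt) τ
      let y₃ := GammaZeroTwo.dq (GammaZeroTwo.dq (GammaZeroTwo.dq GammaZeroTwo.Pt)) τ
      3 * y ^ 2 * y₃ ^ 2 - 36 * (y * y₁ * y₂ - y₁ ^ 3) * y₃ + 32 * y * y₂ ^ 3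
        - 3 * (12 * y₁ ^ 2 + y ^ 4) * y₂ ^ 2 + 9 * y ^ 3 * y₁ ^ 2 * y₂
        - 27 / 4 * y ^ 2 * y₁ ^ 4 = 0) ∧
    (∀ (τ : ℍ) (l : ℂ), Complex.exp l = GammaZeroTwo.Pt τ →
      3 * GammaZeroTwo.invJ 2 GammaZeroTwo.Pt l τ ^ 2
        + 64 * GammaZeroTwo.invI 2 GammaZeroTwo.Pt l τ ^ 3
        - 12 * GammaZeroTwo.invI 2 GammaZeroTwo.Pt l τ ^ 2 = 0) ∧
    -- third-order equation for `Q`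
    (∀ τ : ℍ,
      let y := GammaZeroTwo.Q τ
      let y₁ := GammaZeroTwo.dq GammaZeroTwo.Q τ
      let y₂ := GammaZeroTwo.dq (GammaZeroTwo.dq GammaZeroTwo.Q) τ
      let y₃ := GammaZeroTwo.dq (GammaZeroTwo.dq (GammaZeroTwo.dq GammaZeroTwo.Q)) τ
      4 * y ^ 4 * y₃ ^ 2 - 6 * y ^ 2 * y₁ * (6 * y * y₂ - 5 * y₁ ^ 2) * y₃ + 16 * y ^ 3 * y₂ ^ 3
        + y ^ 2 * (21 * y₁ ^ 2 - 4 * y ^ 3) * y₂ ^ 2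
        - 10 * y * y₁ ^ 2 * (6 * y₁ ^ 2 - y ^ 3) * y₂ + 25 * y₁ ^ 6
        - 25 / 4 * y ^ 3 * y₁ ^ 4 = 0) ∧
    (∀ (τ : ℍ) (l : ℂ), Complex.exp l = GammaZeroTwo.Q τ →
      GammaZeroTwo.invJ 4 GammaZeroTwo.Q l τ ^ 2
        + 16 * GammaZeroTwo.invI 4 GammaZeroTwo.Q l τ ^ 3
        - 16 * GammaZeroTwo.invI 4 GammaZeroTwo.Q l τ ^ 2 = 0) ∧
    -- third-order equation for `D`
    (∀ τ : ℍ,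
      let y := GammaZeroTwo.D τ
      let y₁ := GammaZeroTwo.dq GammaZeroTwo.D τ
      let y₂ := GammaZeroTwo.dq (GammaZeroTwo.dq GammaZeroTwo.D) τ
      let y₃ := GammaZeroTwo.dq (GammaZeroTwo.dq (GammaZeroTwo.dq GammaZeroTwo.D)) τ
      4 * y ^ 4 * y₃ ^ 2 - 6 * y ^ 2 * y₁ * (6 * y * y₂ - 5 * y₁ ^ 2) * y₃ + 16 * y ^ 3 * y₂ ^ 3
        - y ^ 2 * (256 * y ^ 3 - 21 * y₁ ^ 2) * y₂ ^ 2
        + 20 * y * y₁ ^ 2 * (32 * y ^ 3 - 3 * y₁ ^ 2) * y₂ + 25 * y₁ ^ 6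
        - 400 * y ^ 3 * y₁ ^ 4 = 0) ∧
    (∀ (τ : ℍ) (l : ℂ), Complex.exp l = GammaZeroTwo.D τ →
      GammaZeroTwo.invJ 4 GammaZeroTwo.D l τ ^ 2
        + 16 * GammaZeroTwo.invI 4 GammaZeroTwo.D l τ ^ 3
        - 1024 * GammaZeroTwo.invI 4 GammaZeroTwo.D l τ ^ 2 = 0) ∧
    -- third-order equation for `D̃`
    (∀ τ : ℍ,
      let y := GammaZeroTwo.Dt τ
      let y₁ := GammaZeroTwo.dq GammaZeroTwo.Dt τ
      let y₂ := GammaZeroTwo.dq (GammaZeroTwo.dq GammaZeroTwo.Dt) τ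
      let y₃ := GammaZeroTwo.dq (GammaZeroTwo.dq (GammaZeroTwo.dq GammaZeroTwo.Dt)) τ
      16 * y ^ 4 * y₃ ^ 2 - 30 * y ^ 2 * y₁ * (4 * y * y₂ - 3 * y₁ ^ 2) * y₃
        + 32 * y ^ 3 * y₂ ^ 3 + 117 * y ^ 2 * y₁ ^ 2 * y₂ ^ 2
        - 8 * y * (16 * y ^ 5 + 27 * y₁ ^ 4) * y₂ + 81 * y₁ ^ 6
        + 144 * y ^ 5 * y₁ ^ 2 = 0) ∧
    (∀ (τ : ℍ) (l : ℂ), Complex.exp l = GammaZeroTwo.Dt τ →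
      GammaZeroTwo.invJ 8 GammaZeroTwo.Dt l τ ^ 2
        + 16 * GammaZeroTwo.invI 8 GammaZeroTwo.Dt l τ ^ 3
        - 4096 * GammaZeroTwo.invI 8 GammaZeroTwo.Dt l τ = 0) ∧
    -- fourth-order equations in terms of `P_k` and `Q_k`
    GammaZeroTwo.SatisfiesLinearPQ 8 128 (-9) (-912) GammaZeroTwo.Dt ∧
    GammaZeroTwo.SatisfiesLinearPQ 2 4 (-3) (-64) GammaZeroTwo.Pt ∧
    GammaZeroTwo.SatisfiesLinearPQ 4 16 (-5) (-176) GammaZeroTwo.Q ∧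
    GammaZeroTwo.SatisfiesLinearPQ 4 16 (-5) (-176) GammaZeroTwo.D := by
  open GammaZeroTwo in
  refine ⟨⟨hasCovDeriv_P.1, fun τ ↦ ⟨?_, ?_, ?_⟩⟩, hasCuspValues_Pt.exists_modularForm,
    hasCuspValues_Q.exists_modularForm, hasCuspValues_D.exists_modularForm,
    hasCuspValues_Dt.exists_cuspForm, ode_Pt, fun τ l hl ↦ ?_, ode_Q, fun τ l hl ↦ ?_,
    ode_D, fun τ l hl ↦ ?_, ode_Dt, fun τ l hl ↦ ?_, satisfiesLinearPQ_Dt,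
    satisfiesLinearPQ_Pt, satisfiesLinearPQ_Q, satisfiesLinearPQ_D⟩
  · linear_combination hasCovDeriv_P.2 τ
  · linear_combination hasCovDeriv_Pt.2 τ
  · linear_combination hasCovDeriv_Q.2 τ
  · linear_combination 3 * inv_relation_of_covariant_relation (m := 1) one_ne_zero (by norm_num)
      rfl hl (covariant_relation_Pt τ)
  · exact inv_relation_of_covariant_relation (m := 2) two_ne_zero (by norm_num) rfl hl
      (covariant_relation_Q τ)
  · exact inv_relation_of_covariant_relation (m := 2) two_ne_zero (by norm_num) rfl hl
      (covariant_relation_D τ)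
  · simpa only [pow_one] using inv_relation_of_covariant_relation (k := 8) (m := 4) (n := 5)
      (j := 1) four_ne_zero (by norm_num) rfl hl
      (by simpa only [pow_one] using covariant_relation_Dt τ)
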